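/- For a (possibly infinite) simple undirected graph $G$ and a positive integer $r$, let $f_G(r) \in \mathbb{N} \cup \{\infty\}$ be the supremum of $|V(H)|$ over all subgraphs $H$ of $G$ of radius at most $r$, where $H$ has radius at most $r$ if some vertex $v$ of $H$ satisfies $\mathrm{dist}_H(v,w) \leq r$ for every vertex $w$ of $H$. For an integer $k \geq 0$, a $k$-stack layout of $G$ is a pair $(\leq,\varphi)$ where $\leq$ is a linear ordering on $V(G)$ and $\varphi \colon E(G) \to \{1,\dots,k\}$ is a function such that $\varphi(ux) \neq \varphi(vy)$ for any two edges $ux, vy \in E(G)$ with $u<v<x<y$. The stack-number of $G$ is the minimum integer $k \geq 0$ such that $G$ has a $k$-stack layout, or $\infty$ if no such $k$ exists. Theorem. For every real number $c \geq 1$, every (finite or infinite) graph $G$ such that $f_G(r) \leq cr$ for all integers $r \geq 1$ has stack-number at most $49c^2+30c+1$. -/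

import Mathlib

open scoped ENNReal

universe u

/-- The growth `f_G(r)` of a (possibly infinite) graph `G`, for positive integers `r`: the supremum
of `|V(H)|` over all subgraphs `H` of `G` with radius at most `r`. Here `SimpleGraph.radius` is the
minimum eccentricity, computed with the distance inside `H`; it is `⊤` if `H` is disconnected (or
empty). -/
noncomputable def SimpleGraph.growth {V : Type u} (G : SimpleGraph V) (r : ℕ) : ℕ∞ :=
  ⨆ (H : G.Subgraph) (_ : H.coe.radius ≤ (r : ℕ∞)), H.verts.encard

/-- A `k`-stack layout of `G`: a linear ordering of `V(G)` and a colouring of the edges with `k`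
colours such that two edges `ux`, `vy` with `u < v < x < y` always receive distinct colours. -/
structure SimpleGraph.StackLayout {V : Type u} (G : SimpleGraph V) (k : ℕ) where
  /-- the linear ordering of the vertices -/
  order : LinearOrder V
  /-- the assignment of edges to stacks -/
  stack : G.edgeSet → Fin k
  /-- crossing edges lie in distinct stacks -/
  stack_ne : ∀ (u v x y : V) (hux : G.Adj u x) (hvy : G.Adj v y),
    u < v → v < x → x < y → stack ⟨s(u, x), hux⟩ ≠ stack ⟨s(v, y), hvy⟩

/-- The stack-number of `G`: the minimum `k : ℕ` for which a `k`-stack layout exists, and `⊤` if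
there is none. -/
noncomputable def SimpleGraph.stackNumber {V : Type u} (G : SimpleGraph V) : ℕ∞ :=
  ⨅ (k : ℕ) (_ : Nonempty (G.StackLayout k)), (k : ℕ∞)

/-!
The argument shows that `G` has bounded treewidth and turns this into a stack layout.

*From separators to layouts.* A finite vertex set `C` is ordered relative to a boundary `W` of at
most `K` distinctly coloured vertices that come before it, and edges inherit the colour of their
first endpoint. One removes a set `X` from `C`, places it directly after `W` in new colours, and
orders the remaining parts, which are not joined to each other, one after the other and relative to
boundaries inside `W ∪ X`. Two crossing edges have their first endpoints either both in `W ∪ X`,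
where colours are distinct, or within one part and its boundary, where induction applies
(`IsColouredOrder.exists_union`). If `#W < K`, a single vertex is removed. If `#W = K`, one needs a
small separator `L` of `C ∪ W` for which the new boundaries again have at most `K` vertices
(`IsBoundarySplit`, `exists_isColouredOrder`).

*Separators from linear growth.* If `C ∪ W` is connected, breadth-first layers are separators, and
since balls of radius `r` have at most `cr` vertices, one of the layers `r + 1, …, 2r + 1` has at
most `2c` vertices. If no such layer splits `W`, then `W` is concentrated at a single scale: for a
suitable `r` and `w`, all but `2c` vertices of `W` are within distance `2r` of `w`, while every
ball of radius `r` around a vertex of `W` has fewer than `2c` of them. Hence `W` contains many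
vertices at pairwise distance more than `r`, and the disjoint balls of radius `r / 2` around them
fit into a ball of radius at most `5(r + 1) / 2`. Linear growth then bounds `#W` by `10c² + 2c`
(`Connected.exists_splitting_layer`), which is below the required bound with room to spare.

*Infinite graphs.* Layouts of the finite vertex sets have a limit along an ultrafilter
(`nonempty_stackLayout`).
-/

/-! ### Vertex orderings relative to a boundary -/

namespace SimpleGraph

open Finset

variable {V : Type u} [DecidableEq V] {G : SimpleGraph V}

/-- `f` orders the vertices of `C`, thought of as coming after all vertices of a boundary set `W`,
and `col` colours the vertices so that, whenever edges `ux` and `vy` cross with `u` before `v`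
before `x` before `y` and `v ∈ C`, their first endpoints `u` and `v` have distinct colours. The
order of `W` itself is irrelevant, since the colours on `W` are required to be distinct wherever
this notion is used. Neither edges inside `W` nor edges leaving `C ∪ W` are looked at. -/
structure IsColouredOrder (G : SimpleGraph V) (C W : Finset V) {n : ℕ} (f : V → ℕ)
    (col : V → Fin n) : Prop where
  injOn : Set.InjOn f C
  ne : ∀ ⦃u v x y⦄, u ∈ C ∪ W → v ∈ C → x ∈ C → y ∈ C → G.Adj u x → G.Adj v y →
    (u ∈ C → f u < f v) → f v < f x → f x < f y → col u ≠ col v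

/-- Place a set `X` of distinctly coloured vertices first, then `C₁`, then `C₂`, where no edge joins
`C₁` and `C₂`. The coloured orders of the two parts, each relative to a boundary inside `W ∪ X`,
combine to a coloured order of everything. -/
theorem IsColouredOrder.exists_union {n : ℕ} {X C₁ C₂ W W₁ W₂ : Finset V}
    {f₁ f₂ : V → ℕ} {col₀ col₁ col₂ : V → Fin n}
    (hXC₁ : Disjoint X C₁) (hXC₂ : Disjoint X C₂) (hC : Disjoint C₁ C₂)
    (hW : Disjoint W (X ∪ C₁ ∪ C₂))
    (hadj : ∀ a ∈ C₁, ∀ b ∈ C₂, ¬ G.Adj a b)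
    (hadj₁ : ∀ a ∈ C₁, ∀ b ∈ W ∪ X, G.Adj b a → b ∈ W₁)
    (hadj₂ : ∀ a ∈ C₂, ∀ b ∈ W ∪ X, G.Adj b a → b ∈ W₂)
    (hcol : Set.InjOn col₀ (W ∪ X : Finset V))
    (hcol₁ : ∀ w ∈ W₁, col₁ w = col₀ w) (hcol₂ : ∀ w ∈ W₂, col₂ w = col₀ w)
    (h₁ : G.IsColouredOrder C₁ W₁ f₁ col₁) (h₂ : G.IsColouredOrder C₂ W₂ f₂ col₂) :
    ∃ (f : V → ℕ) (col : V → Fin n), (∀ w ∈ W, col w = col₀ w) ∧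
      G.IsColouredOrder (X ∪ C₁ ∪ C₂) W f col := by
  obtain ⟨g, hg⟩ := Set.countable_iff_exists_injOn.1 X.countable_toSet
  set N₀ := X.sup g + 1 with hN₀
  set N₁ := N₀ + C₁.sup f₁ + 1 with hN₁
  have hgN : ∀ x ∈ X, g x < N₀ := fun x hx ↦ Nat.lt_succ_of_le (le_sup hx)
  have hfN : ∀ x ∈ C₁, N₀ + f₁ x < N₁ := fun x hx ↦ by
    have := le_sup (f := f₁) hx
    omega
  set f : V → ℕ := fun v ↦ if v ∈ C₁ then N₀ + f₁ v else if v ∈ C₂ then N₁ + f₂ v else g v with hf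
  set col : V → Fin n := fun v ↦ if v ∈ C₁ then col₁ v else if v ∈ C₂ then col₂ v else col₀ v
    with hcolf
  simp only [Finset.disjoint_left, mem_union] at hXC₁ hXC₂ hC hW
  simp only [mem_union] at hadj₁ hadj₂
  have fX : ∀ v ∈ X, f v = g v := fun v hv ↦ by simp [hf, hXC₁ hv, hXC₂ hv]
  have f1 : ∀ v ∈ C₁, f v = N₀ + f₁ v := fun v hv ↦ by simp [hf, hv]
  have f2 : ∀ v ∈ C₂, f v = N₁ + f₂ v := fun v hv ↦ by
    simp [hf, hv, show v ∉ C₁ from fun h ↦ hC h hv]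
  have c0 : ∀ v, v ∈ W ∨ v ∈ X → col v = col₀ v := fun v hv ↦ by
    have h1 : v ∉ C₁ := fun h ↦ hv.elim (fun hw ↦ hW hw (by tauto)) (fun hx ↦ hXC₁ hx h)
    have h2 : v ∉ C₂ := fun h ↦ hv.elim (fun hw ↦ hW hw (by tauto)) (fun hx ↦ hXC₂ hx h)
    simp [hcolf, h1, h2]
  have c1 : ∀ v ∈ C₁, col v = col₁ v := fun v hv ↦ by simp [hcolf, hv]
  have c2 : ∀ v ∈ C₂, col v = col₂ v := fun v hv ↦ by 
    simp [hcolf, hv, show v ∉ C₁ from fun h ↦ hC h hv]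
  have lt01 : ∀ a ∈ X, ∀ b ∈ C₁, f a < f b := fun a ha b hb ↦ by
    rw [fX a ha, f1 b hb]
    exact (hgN a ha).trans_le (Nat.le_add_right _ _)
  have lt12 : ∀ a ∈ C₁, ∀ b ∈ C₂, f a < f b := fun a ha b hb ↦ by
    rw [f1 a ha, f2 b hb]
    exact (hfN a ha).trans_le (Nat.le_add_right _ _)
  have lt02 : ∀ a ∈ X, ∀ b ∈ C₂, f a < f b := fun a ha b hb ↦ by
    rw [fX a ha, f2 b hb]
    exact (hgN a ha).trans_le (by omega)
  refine ⟨f, col, fun w hw ↦ c0 w (.inl hw), ?_, ?_⟩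
  · intro a ha b hb hab
    simp only [coe_union, Set.mem_union, mem_coe] at ha hb
    rcases ha with (ha | ha) | ha <;> rcases hb with (hb | hb) | hb
    · exact hg ha hb (by rwa [fX a ha, fX b hb] at hab)
    · exact absurd hab (lt01 a ha b hb).ne
    · exact absurd hab (lt02 a ha b hb).ne
    · exact absurd hab (lt01 b hb a ha).ne'
    · exact h₁.injOn ha hb (by rwa [f1 a ha, f1 b hb, Nat.add_left_cancel_iff] at hab)
    · exact absurd hab (lt12 a ha b hb).ne
    · exact absurd hab (lt02 b hb a ha).ne'
    · exact absurd hab (lt12 b hb a ha).ne'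
    · exact h₂.injOn ha hb (by rwa [f2 a ha, f2 b hb, Nat.add_left_cancel_iff] at hab)
  · intro u v x y hu hv hx hy hux hvy huv hvx hxy
    simp only [mem_union] at hu hv hx hy huv
    rcases hv with (hv | hv) | hv
    · -- both `u` and `v` lie in `W ∪ X`, where all colours are distinct
      have hu' : u ∈ W ∨ u ∈ X := by
        rcases hu with ((hu | hu) | hu) | hu
        · exact .inr hu
        · exact absurd (lt01 v hv u hu) (huv (.inl (.inr hu))).asymm
        · exact absurd (lt02 v hv u hu) (huv (.inr hu)).asymm
        · exact .inl hu
      rw [c0 u hu', c0 v (.inr hv)]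
      intro h
      have huv' : u = v := hcol (by simpa using hu') (by simp [hv]) h
      subst huv'
      exact lt_irrefl _ (huv (.inl (.inl hv)))
    · have hy1 : y ∈ C₁ := by
        rcases hy with (hy | hy) | hy
        · exact absurd (lt01 y hy v hv) (hvx.trans hxy).asymm
        · exact hy
        · exact absurd hvy (hadj v hv y hy)
      have hx1 : x ∈ C₁ := by
        rcases hx with (hx | hx) | hx
        · exact absurd (lt01 x hx v hv) hvx.asymm
        · exact hx
        · exact absurd (lt12 y hy1 x hx) hxy.asymm
      have hcu : (u ∈ C₁ ∨ u ∈ W₁) ∧ col u = col₁ u := by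
        have hout : u ∈ W ∨ u ∈ X → (u ∈ C₁ ∨ u ∈ W₁) ∧ col u = col₁ u := fun h ↦ by
          have := hadj₁ x hx1 u h hux
          exact ⟨.inr this, by rw [c0 u h, hcol₁ u this]⟩
        rcases hu with ((hu | hu) | hu) | hu
        · exact hout (.inr hu)
        · exact ⟨.inl hu, c1 u hu⟩
        · exact absurd hux.symm (hadj x hx1 u hu)
        · exact hout (.inl hu)
      rw [hcu.2, c1 v hv]
      rw [f1 v hv, f1 x hx1, Nat.add_lt_add_iff_left] at hvx
      rw [f1 y hy1, f1 x hx1, Nat.add_lt_add_iff_left] at hxy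
      refine h₁.ne (mem_union.2 hcu.1) hv hx1 hy1 hux hvy (fun h ↦ ?_) hvx hxy
      have := huv (.inl (.inr h))
      rwa [f1 u h, f1 v hv, Nat.add_lt_add_iff_left] at this
    · have hx1 : x ∈ C₂ := by
        rcases hx with (hx | hx) | hx
        · exact absurd (lt02 x hx v hv) hvx.asymm
        · exact absurd (lt12 x hx v hv) hvx.asymm
        · exact hx
      have hy1 : y ∈ C₂ := by
        rcases hy with (hy | hy) | hy
        · exact absurd (lt02 y hy x hx1) hxy.asymm
        · exact absurd hvy.symm (hadj y hy v hv)
        · exact hy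
      have hcu : (u ∈ C₂ ∨ u ∈ W₂) ∧ col u = col₂ u := by
        have hout : u ∈ W ∨ u ∈ X → (u ∈ C₂ ∨ u ∈ W₂) ∧ col u = col₂ u := fun h ↦ by
          have := hadj₂ x hx1 u h hux
          exact ⟨.inr this, by rw [c0 u h, hcol₂ u this]⟩
        rcases hu with ((hu | hu) | hu) | hu
        · exact hout (.inr hu)
        · exact absurd hux (hadj u hu x hx1)
        · exact ⟨.inl hu, c2 u hu⟩
        · exact hout (.inl hu)
      rw [hcu.2, c2 v hv]
      rw [f2 v hv, f2 x hx1, Nat.add_lt_add_iff_left] at hvx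
      rw [f2 y hy1, f2 x hx1, Nat.add_lt_add_iff_left] at hxy
      refine h₂.ne (mem_union.2 hcu.1) hv hx1 hy1 hux hvy (fun h ↦ ?_) hvx hxy
      have := huv (.inr h)
      rwa [f2 u h, f2 v hv, Nat.add_lt_add_iff_left] at this

/-- An injective colouring of `W` extends to one of `W ∪ X` if there are enough colours. -/
theorem exists_injOn_union_extension {n : ℕ} {W : Finset V} {col : V → Fin n}
    (hcol : Set.InjOn col W) (X : Finset V) (hcard : #(W ∪ X) ≤ n) :
    ∃ col' : V → Fin n, (∀ w ∈ W, col' w = col w) ∧ Set.InjOn col' (W ∪ X : Finset V) := by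
  induction X using Finset.induction_on with
  | empty => exact ⟨col, fun _ _ ↦ rfl, by simpa using hcol⟩
  | insert a X ha ih =>
    rw [union_insert] at hcard ⊢
    obtain ⟨col', h1, h2⟩ := ih ((card_le_card (subset_insert _ _)).trans hcard)
    by_cases hmem : a ∈ W ∪ X
    · exact ⟨col', h1, by rwa [insert_eq_of_mem hmem]⟩
    · rw [card_insert_of_notMem hmem] at hcard
      obtain ⟨b, -, hb⟩ : ∃ b ∈ (univ : Finset (Fin n)), b ∉ (W ∪ X).image col' :=
        exists_mem_notMem_of_card_lt_card <| by
          have := card_image_le (s := W ∪ X) (f := col')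
          rw [card_fin]
          omega
      have hne : ∀ x ∈ W ∪ X, Function.update col' a b x = col' x := fun x hx ↦
        Function.update_of_ne (by rintro rfl; exact hmem hx) _ _
      refine ⟨Function.update col' a b, fun w hw ↦ ?_, ?_⟩
      · rw [hne w (mem_union_left _ hw), h1 w hw]
      · rw [coe_insert, Set.injOn_insert (by simpa using hmem)]
        refine ⟨fun x hx y hy hxy ↦ ?_, ?_⟩
        · rw [hne x hx, hne y hy] at hxy
          exact h2 hx hy hxy
        · rintro ⟨x, hx, hxb⟩
          rw [hne x hx, Function.update_self] at hxb
          exact hb (mem_image.2 ⟨x, hx, hxb⟩)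

/-- A partition of a vertex set `U` into `A`, `L`, `B`, with `A` and `B` nonempty and not joined by
an edge, in which `L` has at most `l` elements and replacing the part of `W` on the other side by
`L` leaves a boundary of at most `K` vertices for `A` as well as for `B`. -/
structure IsBoundarySplit (G : SimpleGraph V) (U W : Finset V) (K l : ℕ) (A L B : Finset V) :
    Prop where
  union_eq : A ∪ L ∪ B = U
  disjoint_left : Disjoint A L
  disjoint_right : Disjoint L B
  disjoint_sides : Disjoint A B
  not_adj : ∀ a ∈ A, ∀ b ∈ B, ¬ G.Adj a b
  nonempty_left : A.Nonempty
  nonempty_right : B.Nonempty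
  card_left : #(W ∩ A) + #L ≤ K
  card_right : #(W ∩ B) + #L ≤ K
  card_sep : #L ≤ l

/-- If every boundary of size `K` admits a split, then coloured orders with `K + l` colours exist
relative to every boundary of size at most `K`. A boundary that is too small is enlarged by a single
vertex of `C`, a boundary of size `K` is split along `L`. -/
theorem exists_isColouredOrder {K l : ℕ} (hl : 1 ≤ l)
    (hsplit : ∀ U W : Finset V, W ⊆ U → #W = K → ∃ A L B, G.IsBoundarySplit U W K l A L B) :
    ∀ (m : ℕ) (C W : Finset V), 2 * #C + #W ≤ m → Disjoint W C → #W ≤ K →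
      ∀ col₀ : V → Fin (K + l), Set.InjOn col₀ W →
        ∃ (f : V → ℕ) (col : V → Fin (K + l)), (∀ w ∈ W, col w = col₀ w) ∧
          G.IsColouredOrder C W f col := by
  intro m
  induction m using Nat.strong_induction_on with
  | _ m ih =>
  intro C W hm hWC hWK col₀ hcol₀
  rcases C.eq_empty_or_nonempty with rfl | ⟨v, hv⟩
  · exact ⟨fun _ ↦ 0, col₀, fun _ _ ↦ rfl, by simp, by simp⟩
  rcases hWK.lt_or_eq with hlt | heq
  · have hvW : v ∉ W := fun h ↦ Finset.disjoint_left.1 hWC h hv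
    have hcard : #(W ∪ {v}) = #W + 1 := by
      rw [card_union_of_disjoint (by simpa using hvW), card_singleton]
    obtain ⟨col₁, h1, h2⟩ := exists_injOn_union_extension hcol₀ {v} (by omega)
    have hCv : #(C.erase v) + 1 = #C := card_erase_add_one hv
    obtain ⟨f, col, h3, h4⟩ := ih (2 * #(C.erase v) + #(W ∪ {v})) (by omega) (C.erase v) (W ∪ {v})
      le_rfl (by
        rw [Finset.disjoint_union_left]
        exact ⟨hWC.mono_right (erase_subset _ _), by simp⟩) (by omega) col₁ h2
    have hu : {v} ∪ C.erase v ∪ ∅ = C := by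
      rw [union_empty, ← insert_eq, insert_erase hv]
    have := IsColouredOrder.exists_union (G := G) (X := {v}) (C₁ := C.erase v) (C₂ := ∅) (W := W)
      (W₂ := ∅) (f₂ := fun _ ↦ 0) (col₂ := col₁) (by simp) (by simp) (by simp) (by rwa [hu])
      (by simp) (fun _ _ b hb _ ↦ hb) (by simp) h2 h3 (by simp) h4 ⟨by simp, by simp⟩
    rw [hu] at this
    obtain ⟨f', col', h5, h6⟩ := this
    exact ⟨f', col', fun w hw ↦ (h5 w hw).trans (h1 w hw), h6⟩
  · obtain ⟨A, L, B, hs⟩ := hsplit (C ∪ W) W subset_union_right heq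
    have hmem : ∀ z, z ∈ C ∨ z ∈ W ↔ (z ∈ A ∨ z ∈ L) ∨ z ∈ B := fun z ↦ by
      rw [← mem_union, ← hs.union_eq, mem_union, mem_union]
    have hWC' := Finset.disjoint_left.1 hWC
    have hAL := Finset.disjoint_left.1 hs.disjoint_left
    have hLB := Finset.disjoint_left.1 hs.disjoint_right
    have hAB := Finset.disjoint_left.1 hs.disjoint_sides
    have hu : C ∩ L ∪ C ∩ A ∪ C ∩ B = C := by
      ext z
      have := hmem z
      simp only [mem_union, mem_inter]
      tauto
    have hL : #(C ∩ L) ≤ l := (card_le_card inter_subset_right).trans hs.card_sep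
    obtain ⟨col, h1, h2⟩ := exists_injOn_union_extension hcol₀ (C ∩ L) (by
      have := card_union_le W (C ∩ L)
      omega)
    -- the two new boundaries are coloured injectively, as they lie in `W ∪ (C ∩ L)`
    have hsub : ∀ D : Finset V, W ∩ D ∪ L ⊆ W ∪ C ∩ L := fun D z hz ↦ by
      have := hmem z
      simp only [mem_union, mem_inter] at hz ⊢
      tauto
    have hC : #(C ∩ A) + #(C ∩ L) + #(C ∩ B) = #C := by
      rw [← card_union_of_disjoint, ← card_union_of_disjoint, union_comm (C ∩ A), hu]
      · rw [Finset.disjoint_left]; simp only [mem_union, mem_inter]; intro z; have := @hAB z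
        have := @hLB z; tauto
      · exact hs.disjoint_left.mono inter_subset_right inter_subset_right
    have hW : #(W ∩ A) + #(W ∩ L) + #(W ∩ B) = #W := by
      rw [← card_union_of_disjoint, ← card_union_of_disjoint]
      · congr 1; ext z; have := hmem z; simp only [mem_union, mem_inter]; tauto
      · rw [Finset.disjoint_left]; simp only [mem_union, mem_inter]; intro z; have := @hAB z
        have := @hLB z; tauto
      · exact hs.disjoint_left.mono inter_subset_right inter_subset_right
    have hLcard : #(C ∩ L) + #(W ∩ L) = #L := by
      rw [← card_union_of_disjoint]
      · congr 1; ext z; have := hmem z; simp only [mem_union, mem_inter]; tauto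
      · exact hWC.symm.mono inter_subset_left inter_subset_left
    have hpos : ∀ D : Finset V, D.Nonempty → D ⊆ C ∪ W → 1 ≤ #(C ∩ D) + #(W ∩ D) := by
      intro D hD hDs
      have := card_pos.2 hD
      have h' : #(C ∩ D ∪ W ∩ D) = #D := by
        rw [← union_inter_distrib_right, inter_eq_right.2 hDs]
      have := card_union_le (C ∩ D) (W ∩ D)
      omega
    have hA1 := hpos A hs.nonempty_left (by
      rw [← hs.union_eq, union_assoc]; exact subset_union_left)
    have hB1 := hpos B hs.nonempty_right (by rw [← hs.union_eq]; exact subset_union_right)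
    have hcl := hs.card_left
    have hcr := hs.card_right
    have hA2 := card_union_le (W ∩ A) L
    have hB2 := card_union_le (W ∩ B) L
    obtain ⟨f₁, col₁, h3, h4⟩ := ih (2 * #(C ∩ A) + #(W ∩ A ∪ L)) (by omega) (C ∩ A) (W ∩ A ∪ L)
      le_rfl (by
        rw [Finset.disjoint_left]; simp only [mem_union, mem_inter]; intro z; have := @hWC' z
        have := @hAL z; tauto) (by omega) col (h2.mono (by exact_mod_cast hsub A))
    obtain ⟨f₂, col₂, h5, h6⟩ := ih (2 * #(C ∩ B) + #(W ∩ B ∪ L)) (by omega) (C ∩ B) (W ∩ B ∪ L)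
      le_rfl (by
        rw [Finset.disjoint_left]; simp only [mem_union, mem_inter]; intro z; have := @hWC' z
        have := @hLB z; tauto) (by omega) col (h2.mono (by exact_mod_cast hsub B))
    have := IsColouredOrder.exists_union (G := G) (X := C ∩ L) (C₁ := C ∩ A) (C₂ := C ∩ B) (W := W)
      (hs.disjoint_left.symm.mono inter_subset_right inter_subset_right)
      (hs.disjoint_right.mono inter_subset_right inter_subset_right)
      (hs.disjoint_sides.mono inter_subset_right inter_subset_right) (by rwa [hu])
      (fun a ha b hb ↦ hs.not_adj a (mem_inter.1 ha).2 b (mem_inter.1 hb).2)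
      (fun a ha b hb hba ↦ by
        have h' : b ∉ B := fun h ↦ hs.not_adj a (mem_inter.1 ha).2 b h hba.symm
        have := hmem b
        simp only [mem_union, mem_inter] at hb ⊢
        tauto)
      (fun a ha b hb hba ↦ by
        have h' : b ∉ A := fun h ↦ hs.not_adj b h a (mem_inter.1 ha).2 hba
        have := hmem b
        simp only [mem_union, mem_inter] at hb ⊢
        tauto) h2 h3 h5 h4 h6
    rw [hu] at this
    obtain ⟨f, col', h7, h8⟩ := this
    exact ⟨f, col', fun w hw ↦ (h7 w hw).trans (h1 w hw), h8⟩

end SimpleGraph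

/-! ### Compactness -/

namespace SimpleGraph

open Filter

variable {V : Type u} {G : SimpleGraph V}

/-- If every finite vertex set has a coloured order with `n` colours, then `G` has an `n`-stack
layout. The order is the one that an ultrafilter on the finite sets of vertices sees, obtained by
mapping the vertices to the ultrapower of `ℕ`, and an edge gets the limit colour of its smaller
endpoint. -/
theorem nonempty_stackLayout [DecidableEq V] {n : ℕ}
    (h : ∀ S : Finset V, ∃ (f : V → ℕ) (col : V → Fin n), G.IsColouredOrder S ∅ f col) :
    Nonempty (G.StackLayout n) := by
  choose f col hf using h
  let 𝒰 : Ultrafilter (Finset V) := Ultrafilter.of atTop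
  have hmem : ∀ v, ∀ᶠ S in (𝒰 : Filter (Finset V)), v ∈ S := fun v ↦
    Ultrafilter.of_le atTop <| (eventually_ge_atTop {v}).mono fun S hS ↦ by simpa using hS
  let g : V → Germ (𝒰 : Filter (Finset V)) ℕ := fun v ↦ ↑(fun S ↦ f S v)
  have hg : Function.Injective g := fun v w hvw ↦ by
    obtain ⟨S, h1, h2, h3⟩ := ((Germ.coe_eq.1 hvw).and ((hmem v).and (hmem w))).exists
    exact (hf S).injOn h2 h3 h1
  have hcol : ∀ v, ∃ a, ∀ᶠ S in (𝒰 : Filter (Finset V)), col S v = a := fun v ↦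
    Ultrafilter.eventually_exists_iff.1 (.of_forall fun S ↦ ⟨col S v, rfl⟩)
  choose c hc using hcol
  let ord : LinearOrder V := LinearOrder.lift' g hg
  have hlt : ∀ {v w : V}, v < w → ∀ᶠ S in (𝒰 : Filter (Finset V)), f S v < f S w :=
    fun {v w} hvw ↦ Germ.coe_lt.1 (show g v < g w from hvw)
  refine ⟨⟨ord, fun e ↦ c e.1.inf, fun u v x y hux hvy huv hvx hxy ↦ ?_⟩⟩
  simp only [Sym2.inf_mk, inf_of_le_left (huv.trans hvx).le, inf_of_le_left (hvx.trans hxy).le]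
  obtain ⟨S, ⟨⟨h1, h2, h3⟩, h4, h5, h6, h7⟩, h8, h9⟩ :=
    (((hlt huv).and ((hlt hvx).and (hlt hxy))).and ((hmem u).and ((hmem v).and
      ((hmem x).and (hmem y)))) |>.and ((hc u).and (hc v))).exists
  rw [← h8, ← h9]
  exact (hf S).ne (by simpa using h4) h5 h6 h7 hux hvy (fun _ ↦ h1) h2 h3

end SimpleGraph

/-! ### Breadth-first layers that split a set -/

namespace SimpleGraph

open Finset

section Layers

variable {V : Type u} {G : SimpleGraph V}

theorem Connected.exists_dist_eq (hG : G.Connected) {s x : V} {n : ℕ} (hn : n ≤ G.dist s x) :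
    ∃ y, G.dist s y = n := by
  obtain ⟨p, hp⟩ := hG.exists_walk_length_eq_dist s x
  refine ⟨p.getVert n, ?_⟩
  have h1 := dist_le (p.take n)
  have h2 := dist_le (p.drop n)
  have h3 := hG.dist_triangle (u := s) (v := p.getVert n) (w := x)
  rw [Walk.take_length] at h1
  rw [Walk.drop_length] at h2
  omega

variable [Fintype V]

theorem Connected.lt_card_ball (hG : G.Connected) {s x : V} {n : ℕ} (hn : n ≤ G.dist s x) :
    n < #{y | G.dist s y ≤ n} := by
  have h : range (n + 1) ⊆ ({y | G.dist s y ≤ n} : Finset V).image (G.dist s) := fun k hk ↦ by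
    have hk' : k ≤ n := Nat.lt_succ_iff.1 (mem_range.1 hk)
    obtain ⟨y, rfl⟩ := hG.exists_dist_eq (hk'.trans hn)
    exact mem_image_of_mem _ (by simpa using hk')
  have := (card_le_card h).trans card_image_le
  rwa [card_range] at this

variable {c : ℝ}

/-- Linear growth forces one of the `r + 1` layers at distances `r + 1, …, 2r + 1` to be small. -/
theorem exists_card_layer_le (hc : 1 ≤ c) {w : V}
    (hball : ∀ r : ℕ, 1 ≤ r → (#{x | G.dist w x ≤ r} : ℝ) ≤ c * r) (r : ℕ) :
    ∃ j, r + 1 ≤ j ∧ j ≤ 2 * r + 1 ∧ (#{x | G.dist w x = j} : ℝ) ≤ 2 * c := by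
  by_contra! h
  have h1 := card_eq_sum_card_fiberwise (f := G.dist w)
    (s := {x | G.dist w x ∈ Icc (r + 1) (2 * r + 1)}) (t := Icc (r + 1) (2 * r + 1))
    (fun x hx ↦ by simpa using hx)
  have h2 : ∀ j ∈ Icc (r + 1) (2 * r + 1),
      2 * c ≤ (#{x ∈ ({x | G.dist w x ∈ Icc (r + 1) (2 * r + 1)} : Finset V) |
        G.dist w x = j} : ℝ) := fun j hj ↦ by
    have hj' := mem_Icc.1 hj
    rw [filter_filter]
    refine (h j hj'.1 hj'.2).le.trans_eq ?_
    congr 2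
    ext x
    simp only [mem_filter, mem_univ, true_and]
    exact ⟨fun hx ↦ ⟨hx ▸ hj, hx⟩, fun hx ↦ hx.2⟩
  have h3 := card_nsmul_le_sum _ _ _ h2
  rw [← Nat.cast_sum, ← h1, Nat.card_Icc, nsmul_eq_mul,
    show 2 * r + 1 + 1 - (r + 1) = r + 1 by omega] at h3
  have h4 : #{x | G.dist w x ∈ Icc (r + 1) (2 * r + 1)} ≤ #{x | G.dist w x ≤ 2 * r + 1} :=
    card_le_card fun x hx ↦ by
      simp only [mem_filter, mem_univ, true_and, mem_Icc] at hx ⊢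
      exact hx.2
  have h5 := hball (2 * r + 1) (by omega)
  have h6 : (#{x | G.dist w x ∈ Icc (r + 1) (2 * r + 1)} : ℝ) ≤ #{x | G.dist w x ≤ 2 * r + 1} := by
    exact_mod_cast h4
  push_cast at h3 h5
  nlinarith

/-- Vertices at pairwise distance more than `r` inside a ball of radius `2r` number at most `5c`,
since the balls of radius `r / 2` around them are disjoint. -/
theorem Connected.card_separated_le [DecidableEq V] (hG : G.Connected) {w : V} {r : ℕ}
    (hball : ∀ r : ℕ, 1 ≤ r → (#{x | G.dist w x ≤ r} : ℝ) ≤ c * r) (hc : 1 ≤ c) {S : Finset V}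
    (hS : ∀ s ∈ S, G.dist w s ≤ 2 * r) (hsep : ∀ s ∈ S, ∀ t ∈ S, s ≠ t → r < G.dist s t)
    (hfar : ∀ s ∈ S, ∃ x, r < G.dist s x) : (#S : ℝ) ≤ 5 * c := by
  have h1 : #(S.biUnion fun s ↦ {x | G.dist s x ≤ r / 2}) = ∑ s ∈ S, #{x | G.dist s x ≤ r / 2} := by
    refine card_biUnion fun s hs t ht hst ↦ Finset.disjoint_left.2 fun x hx hx' ↦ ?_
    simp only [mem_filter, mem_univ, true_and] at hx hx'
    have := hG.dist_triangle (u := s) (v := x) (w := t)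
    have := hsep s hs t ht hst
    rw [dist_comm (u := x) (v := t)] at *
    omega
  have h2 : #S • (r / 2 + 1) ≤ ∑ s ∈ S, #{x | G.dist s x ≤ r / 2} :=
    card_nsmul_le_sum _ _ _ fun s hs ↦ by
      obtain ⟨x, hx⟩ := hfar s hs
      exact hG.lt_card_ball (x := x) (by omega)
  have h3 : #(S.biUnion fun s ↦ {x | G.dist s x ≤ r / 2}) ≤
      #{x | G.dist w x ≤ 2 * r + r / 2 + 1} := card_le_card fun x hx ↦ by
    simp only [mem_biUnion, mem_filter, mem_univ, true_and] at hx ⊢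
    obtain ⟨s, hs, hx⟩ := hx
    have := hG.dist_triangle (u := w) (v := s) (w := x)
    have := hS s hs
    omega
  have h4 := hball (2 * r + r / 2 + 1) (by omega)
  have h5 : (#S : ℝ) * ((r / 2 : ℕ) + 1) ≤ #{x | G.dist w x ≤ 2 * r + r / 2 + 1} := by
    have := (h2.trans h1.ge).trans h3
    rw [smul_eq_mul] at this
    exact_mod_cast this
  have h6 : (r : ℝ) ≤ 2 * (r / 2 : ℕ) + 1 := by
    exact_mod_cast (by omega : r ≤ 2 * (r / 2) + 1)
  push_cast at h4
  have h7 : (0 : ℝ) ≤ (r / 2 : ℕ) := Nat.cast_nonneg _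
  have h8 : c * (2 * r + (r / 2 : ℕ) + 1) ≤ 5 * c * ((r / 2 : ℕ) + 1) := by
    nlinarith
  exact le_of_mul_le_mul_right ((h5.trans h4).trans h8) (by positivity)

/-- Every set `W` of more than `10c² + 2c` vertices is split by some breadth-first layer with at
most `2c` vertices, in the sense that the inside and the outside, with the layer included, both
contain at least as many vertices of `W` as the layer has vertices, and the outside even more, so
that it is not just the layer.

Otherwise let `r` be the largest radius for which every ball of radius `r` around a vertex of `W`
has fewer than `2c` vertices of `W`, and let `w` be a vertex of `W` for which this fails at radius
`r + 1`. As a small layer beyond `r` does not split `W`, nearly all of `W` is within distance `2r`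
of `w`. It is covered by the balls of radius `r` around a maximal `r`-separated subset, and there
are few such balls. -/
theorem Connected.exists_splitting_layer [DecidableEq V] (hG : G.Connected) (hc : 1 ≤ c)
    (hball : ∀ w, ∀ r : ℕ, 1 ≤ r → (#{x | G.dist w x ≤ r} : ℝ) ≤ c * r) {W : Finset V}
    (hW : 10 * c ^ 2 + 2 * c < #W) :
    ∃ w i, 1 ≤ i ∧ (#{x | G.dist w x = i} : ℝ) ≤ 2 * c ∧
      #{x | G.dist w x = i} ≤ #{x ∈ W | G.dist w x ≤ i} ∧
      #{x | G.dist w x = i} < #{x ∈ W | i ≤ G.dist w x} := by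
  by_contra! hno
  have hWpos : 0 < #W := by
    have : (0 : ℝ) < #W := lt_of_le_of_lt (by positivity) hW
    exact_mod_cast this
  obtain ⟨w₀, hw₀⟩ := card_pos.1 hWpos
  have hex : ∃ r : ℕ, ∃ w ∈ W, 2 * c ≤ #{x ∈ W | G.dist w x ≤ r} := by
    refine ⟨W.sup (G.dist w₀), w₀, hw₀, ?_⟩
    rw [filter_true_of_mem fun x hx ↦ le_sup (f := G.dist w₀) hx]
    nlinarith
  classical
  obtain ⟨w, hw, hwr⟩ := Nat.find_spec hex
  have hmin : ∀ k < Nat.find hex, ∀ s ∈ W, (#{x ∈ W | G.dist s x ≤ k} : ℝ) < 2 * c := by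
    intro k hk s hs
    have := Nat.find_min hex hk
    push Not at this
    exact this s hs
  obtain ⟨r, hr⟩ : ∃ r, Nat.find hex = r + 1 := by
    refine Nat.exists_eq_succ_of_ne_zero fun h0 ↦ ?_
    rw [h0] at hwr
    have : #{x ∈ W | G.dist w x ≤ 0} ≤ 1 := card_le_one.2 fun a ha b hb ↦ by
      simp only [mem_filter, Nat.le_zero, hG.dist_eq_zero_iff] at ha hb
      exact ha.2.symm.trans hb.2
    have : (#{x ∈ W | G.dist w x ≤ 0} : ℝ) ≤ 1 := by exact_mod_cast this
    linarith
  rw [hr] at hwr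
  have hsmall := hmin r (by omega)
  obtain ⟨j, hj1, hj2, hj3⟩ := exists_card_layer_le hc (hball w) r
  have hcut : #{x ∈ W | j ≤ G.dist w x} ≤ #{x | G.dist w x = j} := by
    refine hno w j (by omega) hj3 ?_
    have h1 : #{x ∈ W | G.dist w x ≤ r + 1} ≤ #{x ∈ W | G.dist w x ≤ j} :=
      card_le_card (monotone_filter_right _ fun x _ hx ↦ le_trans hx hj1)
    have h2 : (#{x ∈ W | G.dist w x ≤ r + 1} : ℝ) ≤ #{x ∈ W | G.dist w x ≤ j} := by exact_mod_cast h1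
    exact_mod_cast hj3.trans (hwr.trans h2)
  have hsplit : #W ≤ #{x ∈ W | G.dist w x ≤ 2 * r} + #{x ∈ W | j ≤ G.dist w x} := by
    refine (card_le_card fun x hx ↦ ?_).trans (card_union_le _ _)
    simp only [mem_union, mem_filter]
    have : G.dist w x ≤ 2 * r ∨ j ≤ G.dist w x := by omega
    tauto
  set W' := {x ∈ W | G.dist w x ≤ 2 * r} with hW'
  have hW'card : 10 * c ^ 2 < #W' := by
    have h1 : (#W : ℝ) ≤ #W' + #{x ∈ W | j ≤ G.dist w x} := by exact_mod_cast hsplit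
    have h2 : (#{x ∈ W | j ≤ G.dist w x} : ℝ) ≤ #{x | G.dist w x = j} := by exact_mod_cast hcut
    linarith
  obtain ⟨S, hS⟩ := (W'.powerset.filter fun S ↦ ∀ s ∈ S, ∀ t ∈ S, s ≠ t →
    r < G.dist s t).exists_maximal ⟨∅, by simp⟩
  have hSmem := hS.prop
  simp only [mem_filter, mem_powerset] at hSmem
  have hcover : W' ⊆ S.biUnion fun s ↦ {x ∈ W | G.dist s x ≤ r} := by
    intro x hx
    by_contra hxS
    have hxW : x ∈ W := (mem_filter.1 hx).1
    simp only [mem_biUnion, mem_filter, not_exists, not_and, not_le] at hxS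
    have hins : insert x S ⊆ S := by
      refine hS.2 (mem_filter.2 ⟨mem_powerset.2 (insert_subset hx hSmem.1), ?_⟩) (subset_insert _ _)
      intro s hs t ht hst
      rcases mem_insert.1 hs with rfl | hs' <;> rcases mem_insert.1 ht with rfl | ht'
      · exact absurd rfl hst
      · rw [dist_comm]
        exact hxS t ht' hxW
      · exact hxS s hs' hxW
      · exact hSmem.2 s hs' t ht' hst
    have := hxS x (hins (mem_insert_self _ _)) hxW
    rw [dist_self] at this
    omega
  have hSW : ∀ s ∈ S, s ∈ W := fun s hs ↦ (mem_filter.1 (hSmem.1 hs)).1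
  have hfar : ∀ s ∈ S, ∃ x, r < G.dist s x := by
    intro s hs
    by_contra! h
    have := hsmall s (hSW s hs)
    rw [filter_true_of_mem fun x _ ↦ h x] at this
    nlinarith
  have hScard := hG.card_separated_le (hball w) hc
    (fun s hs ↦ (mem_filter.1 (hSmem.1 hs)).2) hSmem.2 hfar
  have hsum : (#W' : ℝ) ≤ #S * (2 * c) := by
    have h1 := (card_le_card hcover).trans card_biUnion_le
    have h2 : (∑ s ∈ S, (#{x ∈ W | G.dist s x ≤ r} : ℝ)) ≤ #S • (2 * c) :=
      sum_le_card_nsmul _ _ _ fun s hs ↦ (hsmall s (hSW s hs)).le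
    rw [nsmul_eq_mul] at h2
    refine le_trans ?_ h2
    exact_mod_cast h1
  nlinarith

end Layers

/-! ### Balls and growth -/

variable {V : Type u} {G : SimpleGraph V}

/-- A ball in a connected induced subgraph spans a subgraph of at most its radius, since shortest
paths from the centre stay inside. -/
theorem encard_ball_induce_le_growth {U : Set V} (hU : (G.induce U).Connected) (w : U) (r : ℕ) :
    {x | (G.induce U).dist w x ≤ r}.encard ≤ G.growth r := by
  set B : Set V := Subtype.val '' {x | (G.induce U).dist w x ≤ r} with hB
  have hwB : w.1 ∈ B := ⟨w, by simp, rfl⟩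
  have key : ∀ n ≤ r, ∀ x : U, (G.induce U).dist w x = n → ∀ hx : x.1 ∈ B,
      ((⊤ : G.Subgraph).induce B).coe.edist ⟨w, hwB⟩ ⟨x, hx⟩ ≤ (n : ℕ∞) := by
    intro n
    induction n with
    | zero =>
      intro _ x hx hxB
      rw [hU.dist_eq_zero_iff] at hx
      subst hx
      simp
    | succ n ih =>
      intro hn x hx hxB
      obtain ⟨p, hp⟩ := hU.exists_walk_length_eq_dist w x
      have hlen : p.length = n + 1 := hp.trans hx
      have hadj := p.adj_getVert_succ (i := n) (by omega)
      rw [← hlen, p.getVert_length] at hadj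
      have hd : (G.induce U).dist w (p.getVert n) = n := by
        have h1 := dist_le (p.take n)
        have h2 := hU.dist_triangle (u := w) (v := p.getVert n) (w := x)
        rw [Walk.take_length] at h1
        rw [dist_eq_one_iff_adj.2 hadj] at h2
        omega
      have hyB : (p.getVert n).1 ∈ B := ⟨_, by rw [Set.mem_ofPred_eq, hd]; omega, rfl⟩
      have h3 := ih (by omega) _ hd hyB
      have h4 : ((⊤ : G.Subgraph).induce B).coe.edist ⟨(p.getVert n).1, hyB⟩ ⟨x, hxB⟩ = 1 :=
        edist_eq_one_iff_adj.2 ⟨hyB, hxB, hadj⟩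
      exact SimpleGraph.edist_triangle.trans ((add_le_add h3 h4.le).trans_eq (by push_cast; rfl))
  have hrad : ((⊤ : G.Subgraph).induce B).coe.radius ≤ (r : ℕ∞) := by
    refine (iInf_le _ (⟨w.1, hwB⟩ : ((⊤ : G.Subgraph).induce B).verts)).trans ?_
    rw [eccent_le_iff]
    rintro ⟨_, x, hx, rfl⟩
    exact (key _ hx x rfl ⟨x, hx, rfl⟩).trans (by exact_mod_cast hx)
  rw [← Subtype.val_injective.encard_image]
  exact le_iSup₂_of_le ((⊤ : G.Subgraph).induce B) hrad le_rfl

/-! ### Splitting a boundary -/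

variable [DecidableEq V]

/-- Under linear growth every boundary of `K > 10c² + 2c` vertices admits a split: with an empty
separator if the vertex set at hand is disconnected, and with a breadth-first layer otherwise. -/
theorem exists_isBoundarySplit {c : ℝ} (hc : 1 ≤ c)
    (hG : ∀ r : ℕ, 1 ≤ r → (G.growth r : ℝ≥0∞) ≤ ENNReal.ofReal (c * r)) {K : ℕ}
    (hK : 10 * c ^ 2 + 2 * c < K) (U W : Finset V) (hWU : W ⊆ U) (hW : #W = K) :
    ∃ A L B, G.IsBoundarySplit U W K ⌊2 * c⌋₊ A L B := by
  classical
  have hKpos : 0 < K := by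
    have : (0 : ℝ) < K := lt_of_le_of_lt (by positivity) hK
    exact_mod_cast this
  obtain ⟨w₀, hw₀⟩ : W.Nonempty := card_pos.1 (hW ▸ hKpos)
  set H := G.induce (U : Set V) with hH
  set e : (U : Set V) ↪ V := Function.Embedding.subtype _ with he
  have hmap : (univ : Finset (U : Set V)).map e = U := by
    ext x
    simp [he]
  obtain ⟨W', rfl⟩ : ∃ W' : Finset (U : Set V), W'.map e = W :=
    ⟨W.subtype (· ∈ (U : Set V)), subtype_map_of_mem fun x hx ↦ hWU hx⟩
  rw [card_map] at hW
  by_cases hconn : H.Connected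
  · have hball : ∀ w, ∀ r : ℕ, 1 ≤ r → (#{x | H.dist w x ≤ r} : ℝ) ≤ c * r := by
      intro w r hr
      have h1 := encard_ball_induce_le_growth hconn w r
      have h2 : {x | H.dist w x ≤ r}.encard = #{x | H.dist w x ≤ r} := by
        rw [← Set.encard_coe_eq_coe_finsetCard]
        simp
      rw [h2] at h1
      have h3 : ((#{x | H.dist w x ≤ r} : ℕ∞) : ℝ≥0∞) ≤ ENNReal.ofReal (c * r) :=
        (ENat.toENNReal_le.2 h1).trans (hG r hr)
      rw [ENat.toENNReal_coe, ← ENNReal.ofReal_natCast,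
        ENNReal.ofReal_le_ofReal_iff (by positivity)] at h3
      exact h3
    obtain ⟨w, i, hi, hL, hin, hout⟩ := hconn.exists_splitting_layer hc hball
      (W := W') (by rw [hW]; exact hK)
    have hsum : ∀ (p q : ↥(U : Set V) → Prop) [DecidablePred p] [DecidablePred q],
        (∀ x, p x ↔ ¬ q x) → #{x ∈ W' | p x} + #{x ∈ W' | q x} = K := by
      intro p q _ _ hpq
      rw [← hW, ← card_filter_add_card_filter_not (s := W') q, add_comm]
      congr 2
      exact filter_congr fun x _ ↦ hpq x
    have hinter : ∀ (p : ↥(U : Set V) → Prop) [DecidablePred p],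
        #(W'.map e ∩ ({x | p x} : Finset _).map e) = #{x ∈ W' | p x} := fun p _ ↦ by
      rw [← map_inter, card_map, inter_filter, inter_univ]
    have h1 := hsum (fun x ↦ H.dist w x < i) (fun x ↦ i ≤ H.dist w x) fun x ↦ not_le.symm
    have h2 := hsum (fun x ↦ i < H.dist w x) (fun x ↦ H.dist w x ≤ i) fun x ↦ not_le.symm
    refine ⟨({x | H.dist w x < i} : Finset _).map e, ({x | H.dist w x = i} : Finset _).map e,
      ({x | i < H.dist w x} : Finset _).map e, ?_, ?_, ?_, ?_, ?_, ?_, ?_, ?_, ?_, ?_⟩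
    · rw [← map_union, ← map_union]
      refine Eq.trans ?_ hmap
      congr 1
      ext x
      simpa [or_assoc] using lt_trichotomy (H.dist w x) i
    · rw [disjoint_map]
      exact disjoint_filter.2 fun x _ hx ↦ hx.ne
    · rw [disjoint_map]
      exact disjoint_filter.2 fun x _ hx ↦ hx.not_gt
    · rw [disjoint_map]
      exact disjoint_filter.2 fun x _ hx ↦ hx.not_gt
    · intro a ha b hb hab
      obtain ⟨a, ha', rfl⟩ := mem_map.1 ha
      obtain ⟨b, hb', rfl⟩ := mem_map.1 hb
      have ha'' := (mem_filter.1 ha').2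
      have hb'' := (mem_filter.1 hb').2
      have h3 := hconn.dist_triangle (u := w) (v := a) (w := b)
      rw [dist_eq_one_iff_adj.2 (show H.Adj a b from hab)] at h3
      omega
    · exact map_nonempty.2 ⟨w, by simpa using Nat.lt_of_succ_le hi⟩
    · rw [map_nonempty]
      -- the strict inequality `hout` puts a vertex of `W` properly outside the layer
      by_contra hne
      rw [not_nonempty_iff_eq_empty, filter_eq_empty_iff] at hne
      refine hout.not_ge (card_le_card fun x hx ↦ ?_)
      have h3 := (mem_filter.1 hx).2
      have h4 := hne (mem_univ x)
      exact mem_filter.2 ⟨mem_univ x, by omega⟩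
    · rw [hinter, card_map]
      omega
    · rw [hinter, card_map]
      omega
    · rw [card_map]
      exact Nat.le_floor hL
  · have hne : Nonempty (U : Set V) := ⟨⟨w₀, hWU hw₀⟩⟩
    obtain ⟨a, b, hab⟩ : ∃ a b, ¬ H.Reachable a b := by
      by_contra! h
      exact hconn ⟨h⟩
    have hle : ∀ D : Finset V, #(W'.map e ∩ D) + #(∅ : Finset V) ≤ K := fun D ↦ by
      rw [card_empty, add_zero, ← hW, ← card_map e]
      exact card_le_card inter_subset_left
    refine ⟨({x | H.Reachable a x} : Finset _).map e, ∅, ({x | ¬ H.Reachable a x} : Finset _).map e,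
      ?_, disjoint_empty_right _, disjoint_empty_left _, ?_, ?_, ?_, ?_, hle _, hle _, by simp⟩
    · rw [union_empty, ← map_union, filter_union_filter_not_eq, hmap]
    · rw [disjoint_map]
      exact disjoint_filter_filter_not _ _ _
    · intro x hx y hy hxy
      obtain ⟨x, hx', rfl⟩ := mem_map.1 hx
      obtain ⟨y, hy', rfl⟩ := mem_map.1 hy
      exact (mem_filter.1 hy').2 ((mem_filter.1 hx').2.trans (show H.Adj x y from hxy).reachable)
    · exact map_nonempty.2 ⟨a, by simp⟩
    · exact map_nonempty.2 ⟨b, by simpa using hab⟩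

end SimpleGraph

/-! ### The bound -/

theorem theorem2 (c : ℝ) (hc : 1 ≤ c) {V : Type u} (G : SimpleGraph V)
    (hG : ∀ r : ℕ, 1 ≤ r → (G.growth r : ℝ≥0∞) ≤ ENNReal.ofReal (c * r)) :
    (G.stackNumber : ℝ≥0∞) ≤ ENNReal.ofReal (49 * c ^ 2 + 30 * c + 1) := by
  classical
  set K := ⌊10 * c ^ 2 + 2 * c⌋₊ + 1 with hK
  set l := ⌊2 * c⌋₊ with hl
  have hK1 : 10 * c ^ 2 + 2 * c < K := by
    rw [hK, Nat.cast_add_one]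
    exact Nat.lt_floor_add_one _
  have hl1 : 1 ≤ l := Nat.le_floor (by push_cast; linarith)
  have hn : ((K + l : ℕ) : ℝ) ≤ 49 * c ^ 2 + 30 * c + 1 := by
    have h1 : (⌊10 * c ^ 2 + 2 * c⌋₊ : ℝ) ≤ 10 * c ^ 2 + 2 * c := Nat.floor_le (by positivity)
    have h2 : (l : ℝ) ≤ 2 * c := Nat.floor_le (by positivity)
    rw [hK]
    push_cast
    nlinarith
  have hpos : 0 < K + l := by omega
  have hlay : Nonempty (G.StackLayout (K + l)) := SimpleGraph.nonempty_stackLayout fun S ↦ by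
    obtain ⟨f, col, -, h⟩ := SimpleGraph.exists_isColouredOrder hl1
      (SimpleGraph.exists_isBoundarySplit hc hG hK1) _ S ∅ le_rfl (by simp) (by simp)
      (fun _ ↦ ⟨0, hpos⟩) (by simp)
    exact ⟨f, col, h⟩
  have h1 : G.stackNumber ≤ ((K + l : ℕ) : ℕ∞) := iInf₂_le (K + l) hlay
  refine (ENat.toENNReal_le.2 h1).trans ?_
  rw [ENat.toENNReal_coe, ← ENNReal.ofReal_natCast]
  exact ENNReal.ofReal_le_ofReal hn
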